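/- Let $l,m,n_1,\dots,n_l$ be natural numbers. For $i=1,\dots,l$ let $X_i\subseteq\mathbb R^{n_i}$ be convex and closed, $X=X_1\times\dots\times X_l$, let $f_i:X\to\mathbb R$ be continuous and concave in its $i$-th variable $x_i\in X_i$ (the other variables being fixed), and let $h_i=(h_{i1},\dots,h_{im}):\mathbb R^{n_i}\to\mathbb R^m$ have convex components. Let $b\in\mathbb R^m$ and assume that $$D=\Big\{x\in X \;\Big|\; \sum_{i=1}^l h_i(x_i)\le b\Big\}$$ is nonempty (vector inequalities are componentwise). Put $$\Phi(x,y)=\sum_{i=1}^l \big[f_i(x)-f_i(x_{-i},y_i)\big],\qquad x,y\in X,$$ where $(x_{-i},y_i)$ is $x$ with its $i$-th component replaced by $y_i$. The normalized equilibrium problem is to find $$x^*\in D\ \text{ such that }\ \Phi(x^*,y)\ge 0\quad\forall y\in D. \tag{2.1}$$ Let $U_0\subseteq(\mathbb R^{m})^l$ and $U=\{u\in U_0 \mid \sum_{i=1}^l u_i=b\}$. Assume that $U$ is convex, closed and bounded and that for each $x\in D$ there is $u\in U$ with $h_i(x_i)\le u_i$ for all $i$. Let $\varphi:\mathbb R^m\to\mathbb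 R$ be convex, differentiable and isotone ($u\ge v$ implies $\varphi(u)\ge\varphi(v)$), with $\varphi(v)=0$ if $v\le 0$ and $\varphi(v)>0$ otherwise, and put $P(x,u)=\sum_{i=1}^l\varphi(h_i(x_i)-u_i)$. For $\tau>0$ the penalized problem is to find $$w(\tau)=(x(\tau),u(\tau))\in X\times U\ \text{ such that }\ \Phi(x(\tau),x)+\tau\,[P(w)-P(w(\tau))]\ge 0\quad\forall w=(x,u)\in X\times U. \tag{3.1}$$ Let $\mu:X\to\mathbb R$ be lower semicontinuous and convex, and write $B_\rho=\{x\in X\mid \mu(x)\le\rho\}$. Assume that $B_\rho$ is nonempty and bounded for some $\rho\in\mathbb R$, and let $r\in\mathbb R$ be such that for every $x\in X\setminus B_r$ there is $z\in D$ with $\mu(z)\le\mu(x)$ and $\Phi(x,z)<0$. Finally let $(\tau_k)$ be a nondecreasing sequence of positive numbers with $\tau_k\to+\infty$. Then: (i) problem (2.1) has a solution; (ii) for each $\tau>0$ problem (3.1) has a solution, and all its solutions belong to $B_r\times U$; (iii) each sequence $(w(\tau_k))$, where $w(\tau_k)$ is a solution of (3.1) with $\tau=\tau_k$, has limit points; every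 limit point $(\bar x,\bar u)$ belongs to $(B_r\cap D)\times U$, and $\bar x$ solves (2.1). -/

import Mathlib

/-- The data of a generalized noncooperative game with `l` players and `m` joint constraints.
Player `i` chooses a strategy in `X i ⊆ ℝ^{n i}` and has the utility `f i`, of which only the
values on the product of the strategy sets are ever used; the joint constraint is
`∑ i, h i (x i) ≤ b`, componentwise in `ℝ^m`. -/
structure JointGame (l m : ℕ) (n : Fin l → ℕ) where
  /-- strategy sets -/
  X : (i : Fin l) → Set (Fin (n i) → ℝ)
  /-- utility functions -/
  f : Fin l → ((i : Fin l) → Fin (n i) → ℝ) → ℝ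
  /-- constraint functions -/
  h : (i : Fin l) → (Fin (n i) → ℝ) → (Fin m → ℝ)
  /-- right-hand side of the joint constraint -/
  b : Fin m → ℝ

/-- Strategy profiles `x = (x_1, …, x_l)`. -/
abbrev Profile {l : ℕ} (n : Fin l → ℕ) : Type := (i : Fin l) → Fin (n i) → ℝ

/-- Share allocations `u = (u_1, …, u_l)` with `u_i ∈ ℝ^m`. -/
abbrev Shares (l m : ℕ) : Type := Fin l → Fin m → ℝ

namespace JointGame

variable {l m : ℕ} {n : Fin l → ℕ}

/-- The product `X = X_1 × ⋯ × X_l`. -/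
def prodX (G : JointGame l m n) : Set (Profile n) := {x | ∀ i, x i ∈ G.X i}

/-- The joint constraint set `Y`. -/
def jointY (G : JointGame l m n) : Set (Profile n) := {x | ∑ i, G.h i (x i) ≤ G.b}

/-- The common feasible set `D = X ∩ Y`. -/
def feasible (G : JointGame l m n) : Set (Profile n) := G.prodX ∩ G.jointY

/-- `Ψ(x, y) = ∑ i, f_i(x_{-i}, y_i)`. -/
def Psi (G : JointGame l m n) (x y : Profile n) : ℝ :=
  ∑ i, G.f i (Function.update x i (y i))

/-- The Nikaido–Isoda bifunction `Φ(x, y) = Ψ(x, x) - Ψ(x, y)`. -/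
def Phi (G : JointGame l m n) (x y : Profile n) : ℝ := G.Psi x x - G.Psi x y

/-- The basic assumptions on the game. -/
structure BasicAssumptions (G : JointGame l m n) : Prop where
  convex_X : ∀ i, Convex ℝ (G.X i)
  closed_X : ∀ i, IsClosed (G.X i)
  concave_f : ∀ i, ∀ x ∈ G.prodX, ConcaveOn ℝ (G.X i) fun y => G.f i (Function.update x i y)
  continuous_f : ∀ i, ContinuousOn (G.f i) G.prodX
  convex_h : ∀ i j, ConvexOn ℝ Set.univ fun y => G.h i y j
  feasible_nonempty : G.feasible.Nonempty

/-- `x` is a normalized equilibrium point. -/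
def IsNormalizedEquilibrium (G : JointGame l m n) (x : Profile n) : Prop :=
  x ∈ G.feasible ∧ ∀ y ∈ G.feasible, 0 ≤ G.Phi x y

/-- The level set `B_r = {x ∈ X | μ x ≤ r}`. -/
def levelSet (G : JointGame l m n) (μ : Profile n → ℝ) (r : ℝ) : Set (Profile n) :=
  {x | x ∈ G.prodX ∧ μ x ≤ r}

/-- `μ` is weakly coercive with respect to `X`: some level set is nonempty and bounded. -/
def WeaklyCoercive (G : JointGame l m n) (μ : Profile n → ℝ) : Prop :=
  ∃ ρ : ℝ, (G.levelSet μ ρ).Nonempty ∧ Bornology.IsBounded (G.levelSet μ ρ)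

/-- The coercivity condition, for a given function `μ` on `X` and a given number `r`
(which need not be the level witnessing weak coercivity). -/
structure Coercivity (G : JointGame l m n) (μ : Profile n → ℝ) (r : ℝ) : Prop where
  lsc : LowerSemicontinuousOn μ G.prodX
  convex : ConvexOn ℝ G.prodX μ
  weaklyCoercive : G.WeaklyCoercive μ
  descent : ∀ x ∈ G.prodX \ G.levelSet μ r, ∃ z ∈ G.feasible, μ z ≤ μ x ∧ G.Phi x z < 0

/-- The set `U` of feasible partitions of `b` subject to the additional restrictions `U₀`. -/
def shareSet (G : JointGame l m n) (U₀ : Set (Shares l m)) : Set (Shares l m) :=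
  {u | u ∈ U₀ ∧ ∑ i, u i = G.b}

/-- The standing requirements on the feasible partitions: `U` is convex and closed, and every
jointly feasible profile is supported by some partition in `U`. -/
structure AdmissibleShares (G : JointGame l m n) (U₀ : Set (Shares l m)) : Prop where
  convex : Convex ℝ (G.shareSet U₀)
  closed : IsClosed (G.shareSet U₀)
  covers : ∀ x ∈ G.feasible, ∃ u ∈ G.shareSet U₀, ∀ i, G.h i (x i) ≤ u i

/-- The penalty `P(x, u) = ∑ i, φ(h_i(x_i) - u_i)`. -/
def penalty (G : JointGame l m n) (φ : (Fin m → ℝ) → ℝ) (w : Profile n × Shares l m) : ℝ :=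
  ∑ i, φ (G.h i (w.1 i) - w.2 i)

/-- `Φ_τ(w, w') = Φ(x, x') + τ (P(w') - P(w))` for `w = (x, u)`, `w' = (x', u')`. -/
def penPhi (G : JointGame l m n) (φ : (Fin m → ℝ) → ℝ) (τ : ℝ)
    (w w' : Profile n × Shares l m) : ℝ :=
  G.Phi w.1 w'.1 + τ * (G.penalty φ w' - G.penalty φ w)

/-- `w` solves the penalized equilibrium problem on `X × U` with parameter `τ`. -/
def IsPenalizedSolution (G : JointGame l m n) (U₀ : Set (Shares l m))
    (φ : (Fin m → ℝ) → ℝ) (τ : ℝ) (w : Profile n × Shares l m) : Prop :=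
  w ∈ G.prodX ×ˢ G.shareSet U₀ ∧ ∀ w' ∈ G.prodX ×ˢ G.shareSet U₀, 0 ≤ G.penPhi φ τ w w'

end JointGame

/-- Convex differentiable isotone functions vanishing exactly on the nonpositive orthant and
positive elsewhere. -/
structure IsPenaltyKernel {m : ℕ} (φ : (Fin m → ℝ) → ℝ) : Prop where
  convex : ConvexOn ℝ Set.univ φ
  differentiable : Differentiable ℝ φ
  isotone : Monotone φ
  eq_zero : ∀ v, v ≤ 0 → φ v = 0
  pos : ∀ v, ¬ v ≤ 0 → 0 < φ v

/-!
Penalizing the share constraint `h i (x i) ≤ u i` turns the joint constraint into a problem over the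
product `X × U`. There the penalized bifunction is continuous in its first and convex in its second
argument, and the coercivity condition survives because the descent directions `z ∈ D` extend to
pairs with zero penalty. By Ky Fan's theorem the problem has a solution on a compact convex sublevel
set `μ ≤ ρ` with `ρ > r`; by coercivity this solution satisfies `μ x ≤ r < ρ`, so the restriction
`μ ≤ ρ` is inactive and, by convexity along segments, it solves the problem on all of `X × U`.
Comparison with unpenalized points `y` gives `τ P(w) ≤ Φ(x, y)`, which in the limit `τ → ∞` forces
`P = 0` and keeps `Φ(x, y) ≥ 0`.

Ky Fan's theorem is reduced to Brouwer's by a continuous selection from the convex sets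
`{y | F x y < 0}`, which are locally constantly inhabited. Brouwer's theorem follows from the
Milnor–Rogers argument: if `g` is `C¹` on a convex body `S` and vanishes on its boundary, then
`t ↦ ∫ det (1 + t Dg)` is a polynomial. For small `t` it equals the volume of `S`, because then
`1 + t g` permutes `S`; hence it does so for `t = 1`. For a retraction `1 + g` of the ball onto the
sphere, however, the determinant would vanish identically.
-/

section Determinant

open Module Polynomial

theorem exists_polynomial_eval_eq_det_one_add_smul {R M : Type*} [CommRing R] [Nontrivial R]
    [AddCommGroup M] [Module R M] [Module.Free R M] [Module.Finite R M] (A : M →ₗ[R] M) :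
    ∃ p : R[X], p.natDegree ≤ finrank R M ∧ ∀ t, p.eval t = LinearMap.det (1 + t • A) := by
  let b := Free.chooseBasis R M
  let B := LinearMap.toMatrix b b A
  refine ⟨Matrix.det ((X : R[X]) • B.map C + (1 : Matrix _ _ R).map C), ?_, fun t => ?_⟩
  · rw [finrank_eq_card_chooseBasisIndex]
    exact natDegree_det_X_add_C_le B 1
  · have heval : (evalRingHom t).mapMatrix ((X : R[X]) • B.map C + (1 : Matrix _ _ R).map C) =
        LinearMap.toMatrix b b (1 + t • A) := by
      rw [map_add (LinearMap.toMatrix b b), map_smul, LinearMap.toMatrix_one, add_comm]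
      ext i j
      rcases eq_or_ne i j with rfl | hij
      · simp [B, mul_comm t]
      · simp [B, hij, mul_comm t]
    rw [← coe_evalRingHom, RingHom.map_det, heval, LinearMap.det_toMatrix]

theorem exists_polynomial_eval_eq_integral {α : Type*} [MeasurableSpace α]
    {ν : MeasureTheory.Measure α} {F : ℝ → α → ℝ} {d : ℕ}
    (hF : ∀ x, ∃ p : ℝ[X], p.natDegree ≤ d ∧ ∀ t, p.eval t = F t x)
    (hint : ∀ t, MeasureTheory.Integrable (F t) ν) :
    ∃ p : ℝ[X], ∀ t, p.eval t = ∫ x, F t x ∂ν := by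
  let s := Finset.range (d + 1)
  let L := fun i => Lagrange.basis s (fun k : ℕ => (k : ℝ)) i
  have hinterp : ∀ t x, F t x = ∑ i ∈ s, F i x * (L i).eval t := by
    intro t x
    obtain ⟨p, hdeg, hp⟩ := hF x
    have hlt : p.degree < s.card := by
      rw [Finset.card_range]
      exact degree_le_natDegree.trans_lt (by exact_mod_cast Nat.lt_succ_of_le hdeg)
    have := congrArg (eval t) (Lagrange.eq_interpolate Nat.cast_injective.injOn hlt)
    simpa only [hp, Lagrange.interpolate_apply, eval_finsetSum, eval_mul, eval_C] using this
  refine ⟨∑ i ∈ s, C (∫ x, F i x ∂ν) * L i, fun t => ?_⟩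
  simp_rw [hinterp t, eval_finsetSum, eval_mul, eval_C, ← MeasureTheory.integral_mul_const]
  exact (MeasureTheory.integral_finsetSum s fun i _ => (hint i).mul_const _).symm

theorem det_one_add_pos_of_norm_lt_one {E : Type*} [NormedAddCommGroup E] [NormedSpace ℝ E]
    [FiniteDimensional ℝ E] {A : E →L[ℝ] E} (hA : ‖A‖ < 1) : 0 < (1 + A).det := by
  have := FiniteDimensional.complete ℝ E
  have hne : ∀ s ∈ Set.Icc (0 : ℝ) 1, (1 + s • A).det ≠ 0 := by
    intro s hs
    have hnorm : ‖-(s • A)‖ < 1 := by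
      rw [norm_neg, norm_smul, Real.norm_of_nonneg hs.1]
      exact (mul_le_of_le_one_left (norm_nonneg A) hs.2).trans_lt hA
    have hunit : IsUnit (1 + s • A) := by simpa using isUnit_one_sub_of_norm_lt_one hnorm
    exact ((hunit.map ContinuousLinearMap.toLinearMapRingHom).map LinearMap.det).ne_zero
  have hcont : ContinuousOn (fun s : ℝ => (1 + s • A).det) (Set.Icc 0 1) :=
    (ContinuousLinearMap.continuous_det.comp (by fun_prop)).continuousOn
  by_contra! hneg
  obtain ⟨s, hs, h0⟩ := intermediate_value_Icc' zero_le_one hcont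
    ⟨by simpa using hneg, by simp [ContinuousLinearMap.det]⟩
  exact hne s hs h0

end Determinant

section VolumeIdentity

open MeasureTheory Set

theorem inter_frontier_nonempty_of_isPreconnected {X : Type*} [TopologicalSpace X] {t S : Set X}
    (ht : IsPreconnected t) (hS : (t ∩ S).Nonempty) (hSc : (t ∩ Sᶜ).Nonempty) :
    (t ∩ frontier S).Nonempty := by
  by_contra! hempty
  have hcover : t ⊆ interior S ∪ interior Sᶜ := by
    rw [← compl_frontier_eq_union_interior]
    exact disjoint_iff_inter_eq_empty.2 hempty |>.subset_compl_right
  have hdisj : Disjoint (interior S) (interior Sᶜ) :=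
    disjoint_compl_right.mono interior_subset interior_subset
  obtain ⟨x, hxt, hxS⟩ := hS
  obtain ⟨y, hyt, hyS⟩ := hSc
  rcases ht.subset_or_subset isOpen_interior isOpen_interior hdisj hcover with h | h
  · exact hyS (interior_subset (h hyt))
  · exact interior_subset (h hxt) hxS

theorem lipschitzWith_indicator_of_eqOn_frontier {E F : Type*} [NormedAddCommGroup E]
    [NormedSpace ℝ E] [SeminormedAddCommGroup F] {S : Set E} (hS : IsClosed S) {g : E → F}
    {C : NNReal} (hg : LipschitzOnWith C g S) (h0 : EqOn g 0 (frontier S)) :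
    LipschitzWith C (S.indicator g) := by
  have hmixed : ∀ x ∈ S, ∀ y ∉ S, ‖g x‖ ≤ C * dist x y := by
    intro x hx y hy
    obtain ⟨z, hzseg, hz⟩ := inter_frontier_nonempty_of_isPreconnected
      (convex_segment x y).isPreconnected ⟨x, left_mem_segment ℝ x y, hx⟩
      ⟨y, right_mem_segment ℝ x y, hy⟩
    calc ‖g x‖ = dist (g x) (g z) := by rw [h0 hz, Pi.zero_apply, dist_zero_right]
      _ ≤ C * dist x z := hg.dist_le_mul x hx z (hS.frontier_subset hz)
      _ ≤ C * dist x y := by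
        gcongr
        linarith [dist_add_dist_of_mem_segment hzseg, dist_nonneg (x := z) (y := y)]
  refine LipschitzWith.of_dist_le_mul fun x y => ?_
  by_cases hx : x ∈ S <;> by_cases hy : y ∈ S
  · simpa only [indicator_of_mem hx, indicator_of_mem hy] using hg.dist_le_mul x hx y hy
  · simpa only [indicator_of_mem hx, indicator_of_notMem hy, dist_zero_right] using hmixed x hx y hy
  · simpa only [indicator_of_notMem hx, indicator_of_mem hy, dist_zero_left, dist_comm x y] using
      hmixed y hy x hx
  · simpa only [indicator_of_notMem hx, indicator_of_notMem hy, dist_self] using by positivity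

theorem bijective_add_of_lipschitzWith_lt_one {E : Type*} [NormedAddCommGroup E]
    [NormedSpace ℝ E] [CompleteSpace E] {G : E → E} {c : NNReal} (hc : c < 1)
    (hG : LipschitzWith c G) : Function.Bijective fun x => x + G x := by
  have happrox : ApproximatesLinearOn (fun x => x + G x)
      ((ContinuousLinearEquiv.refl ℝ E : E ≃L[ℝ] E) : E →L[ℝ] E) univ c := by
    intro x _ y _
    simpa [dist_eq_norm, add_sub_add_comm] using hG.dist_le_mul x y
  have hc' : Subsingleton E ∨ c < ‖((ContinuousLinearEquiv.refl ℝ E).symm : E →L[ℝ] E)‖₊⁻¹ := by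
    rcases subsingleton_or_nontrivial E with hE | hE
    · exact Or.inl hE
    · have hnorm : ‖((ContinuousLinearEquiv.refl ℝ E).symm : E →L[ℝ] E)‖₊ = 1 :=
        NNReal.eq ContinuousLinearMap.norm_id
      exact Or.inr (by rwa [hnorm, inv_one])
  exact ⟨injOn_univ.1 (happrox.injOn hc'), happrox.surjective hc'⟩

theorem image_add_eq_of_eqOn_compl {E : Type*} [AddZeroClass E] {G : E → E} {S : Set E}
    (hbij : Function.Bijective fun x => x + G x) (h0 : EqOn G 0 Sᶜ) :
    (fun x => x + G x) '' S = S := by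
  have hcompl : (fun x => x + G x) '' Sᶜ = Sᶜ := by
    rw [image_congr fun x hx => show x + G x = x by rw [h0 hx, Pi.zero_apply, add_zero], image_id']
  rw [← compl_inj_iff, ← image_compl_eq hbij, hcompl]

theorem setIntegral_det_one_add_fderiv_of_lipschitzOnWith_lt_one {E : Type*}
    [NormedAddCommGroup E] [NormedSpace ℝ E] [FiniteDimensional ℝ E] [MeasurableSpace E]
    [BorelSpace E] (ν : Measure E) [ν.IsAddHaarMeasure] {S : Set E} (hS : IsClosed S) {g : E → E}
    {c : NNReal} (hc : c < 1) (hg : LipschitzOnWith c g S)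
    (hd : ∀ x ∈ interior S, DifferentiableAt ℝ g x) (h0 : EqOn g 0 (frontier S)) :
    ∫ x in interior S, (1 + fderiv ℝ g x).det ∂ν = ν.real (interior S) := by
  have := FiniteDimensional.complete ℝ E
  let G := S.indicator g
  have hG0 : EqOn G 0 (interior S)ᶜ := by
    intro x hx
    by_cases hxS : x ∈ S
    · exact (indicator_of_mem hxS g).trans (h0 ⟨subset_closure hxS, hx⟩)
    · exact indicator_of_notMem hxS g
  have hbij : Function.Bijective fun x => x + G x :=
    bijective_add_of_lipschitzWith_lt_one hc (lipschitzWith_indicator_of_eqOn_frontier hS hg h0)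
  have hderiv : ∀ x ∈ interior S,
      HasFDerivWithinAt (fun x => x + G x) (1 + fderiv ℝ g x) (interior S) x := fun x hx =>
    ((hasFDerivAt_id x).add (hd x hx).hasFDerivAt).hasFDerivWithinAt.congr'
      (fun y hy => congrArg (y + ·) (indicator_of_mem (interior_subset hy) g)) hx
  have hdet : ∀ x ∈ interior S, 0 < (1 + fderiv ℝ g x).det := fun x hx =>
    det_one_add_pos_of_norm_lt_one <|
      (norm_fderiv_le_of_lipschitzOn ℝ (mem_interior_iff_mem_nhds.1 hx) hg).trans_lt hc
  have hchange := integral_image_eq_integral_abs_det_fderiv_smul ν isOpen_interior.measurableSet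
    hderiv hbij.injective.injOn fun _ => (1 : ℝ)
  rw [image_add_eq_of_eqOn_compl hbij hG0, setIntegral_const, smul_eq_mul, mul_one] at hchange
  rw [hchange]
  exact setIntegral_congr_fun isOpen_interior.measurableSet fun x hx => by
    rw [smul_eq_mul, mul_one, abs_of_pos (hdet x hx)]

theorem setIntegral_det_one_add_fderiv {E : Type*} [NormedAddCommGroup E] [NormedSpace ℝ E]
    [FiniteDimensional ℝ E] [MeasurableSpace E] [BorelSpace E] (ν : Measure E)
    [ν.IsAddHaarMeasure] {S : Set E} (hS : IsCompact S) (hconv : Convex ℝ S) {g : E → E}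
    (hg : ∀ x ∈ S, ContDiffAt ℝ 1 g x) (h0 : EqOn g 0 (frontier S)) :
    ∫ x in interior S, (1 + fderiv ℝ g x).det ∂ν = ν.real (interior S) := by
  obtain ⟨C, hC⟩ := ContDiffOn.exists_lipschitzOnWith
    (fun x hx => (hg x hx).contDiffWithinAt) one_ne_zero hconv hS
  have hd : ∀ x ∈ interior S, DifferentiableAt ℝ g x := fun x hx =>
    (hg x (interior_subset hx)).differentiableAt one_ne_zero
  have hcont : ContinuousOn (fderiv ℝ g) S := fun x hx =>
    ((hg x hx).continuousAt_fderiv one_ne_zero).continuousWithinAt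
  have hint : ∀ t : ℝ, IntegrableOn (fun x => (1 + t • fderiv ℝ g x).det) (interior S) ν :=
    fun t => ((ContinuousLinearMap.continuous_det.comp_continuousOn
      (continuousOn_const.add (hcont.const_smul t))).integrableOn_compact hS).mono_set
        interior_subset
  obtain ⟨p, hp⟩ : ∃ p : Polynomial ℝ, ∀ t,
      p.eval t = ∫ x in interior S, (1 + t • fderiv ℝ g x).det ∂ν :=
    exists_polynomial_eval_eq_integral
      (fun x => exists_polynomial_eval_eq_det_one_add_smul (fderiv ℝ g x : E →ₗ[ℝ] E)) hint
  have hsmall : ∀ t ∈ Ioo (0 : ℝ) (1 / (C + 1)), p.eval t = ν.real (interior S) := by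
    rintro t ⟨ht0, ht1⟩
    have htC : ‖t‖₊ * C < 1 := by
      rw [lt_div_iff₀ (by positivity)] at ht1
      rw [← NNReal.coe_lt_coe]
      simp only [NNReal.coe_mul, coe_nnnorm, Real.norm_of_nonneg ht0.le, NNReal.coe_one]
      linarith
    rw [hp, ← setIntegral_det_one_add_fderiv_of_lipschitzOnWith_lt_one ν hS.isClosed
      (g := fun x => t • g x) htC ((lipschitzWith_smul t).comp_lipschitzOnWith hC)
      (fun x hx => (hd x hx).const_smul t) fun x hx => by simp [h0 hx]]
    refine setIntegral_congr_fun isOpen_interior.measurableSet fun x hx => ?_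
    simp only [fderiv_fun_const_smul (hd x hx) t]
  have hconst : p = Polynomial.C (ν.real (interior S)) :=
    Polynomial.eq_of_infinite_eval_eq _ _ <|
      (Ioo_infinite (by positivity : (0 : ℝ) < 1 / (C + 1))).mono fun t ht => by
        simpa using hsmall t ht
  simpa only [hconst, Polynomial.eval_C, one_smul] using (hp 1).symm

end VolumeIdentity

section Brouwer

open Metric Set

section InnerProductSpace

variable {E : Type*} [NormedAddCommGroup E] [InnerProductSpace ℝ E]

theorem det_fderiv_eq_zero_of_norm_eq_one [FiniteDimensional ℝ E] {f : E → E} {x : E}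
    (hf : DifferentiableAt ℝ f x) (hnorm : ∀ᶠ y in nhds x, ‖f y‖ = 1) : (fderiv ℝ f x).det = 0 := by
  by_contra hdet
  have hunit : IsUnit (fderiv ℝ f x : E →ₗ[ℝ] E) :=
    (LinearMap.isUnit_iff_isUnit_det _).2 (isUnit_iff_ne_zero.2 hdet)
  obtain ⟨v, hv⟩ := ((Module.End.isUnit_iff _).1 hunit).2 (f x)
  have hderiv : HasFDerivAt (fun y => ‖f y‖ ^ 2) (2 • (innerSL ℝ (f x)).comp (fderiv ℝ f x)) x :=
    hf.hasFDerivAt.norm_sq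
  have hconst : HasFDerivAt (fun y => ‖f y‖ ^ 2) (0 : E →L[ℝ] ℝ) x :=
    (hasFDerivAt_const (1 : ℝ) x).congr_of_eventuallyEq (hnorm.mono fun y hy => by simp [hy])
  have hzero := congrArg (fun L : E →L[ℝ] ℝ => L v) (hderiv.unique hconst)
  have hv' : fderiv ℝ f x v = f x := hv
  simp [hv', hnorm.self_of_nhds] at hzero

theorem not_exists_contDiff_retraction_sphere [FiniteDimensional ℝ E] :
    ¬ ∃ f : E → E, (∀ x ∈ closedBall (0 : E) 1, ContDiffAt ℝ 1 f x) ∧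
      (∀ x ∈ sphere (0 : E) 1, f x = x) ∧ MapsTo f (closedBall 0 1) (sphere 0 1) := by
  rintro ⟨f, hf, hfix, hmaps⟩
  borelize E
  let ν : MeasureTheory.Measure E := MeasureTheory.Measure.addHaar
  have hvolume := setIntegral_det_one_add_fderiv ν (isCompact_closedBall (0 : E) 1)
    (convex_closedBall 0 1) (g := fun x => f x - x) (fun x hx => (hf x hx).sub contDiffAt_id)
    fun x hx => sub_eq_zero.2 <| hfix x <| by rwa [frontier_closedBall _ one_ne_zero] at hx
  rw [interior_closedBall _ one_ne_zero] at hvolume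
  have hvanish : ∀ x ∈ ball (0 : E) 1, (1 + fderiv ℝ (fun x => f x - x) x).det = 0 := by
    intro x hx
    have hdiff : DifferentiableAt ℝ f x :=
      (hf x (ball_subset_closedBall hx)).differentiableAt one_ne_zero
    have hfderiv : 1 + fderiv ℝ (fun x => f x - x) x = fderiv ℝ f x := by
      rw [fderiv_fun_sub hdiff differentiableAt_fun_id, fderiv_fun_id, ContinuousLinearMap.one_def,
        add_sub_cancel]
    rw [hfderiv]
    refine det_fderiv_eq_zero_of_norm_eq_one hdiff ?_
    filter_upwards [isOpen_ball.mem_nhds hx] with y hy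
    exact mem_sphere_zero_iff_norm.1 (hmaps (ball_subset_closedBall hy))
  rw [MeasureTheory.setIntegral_congr_fun isOpen_ball.measurableSet hvanish,
    MeasureTheory.integral_zero] at hvolume
  have hpos : 0 < ν.real (ball 0 1) := ENNReal.toReal_pos
    (measure_ball_pos ν 0 one_pos).ne' MeasureTheory.measure_ball_lt_top.ne
  exact hpos.ne hvolume

/-- The parameter at which the ray from `x` in the direction `u` leaves the unit ball: the larger
root `t` of `‖x + t • u‖ ^ 2 = 1`. It is meaningful for `‖x‖ ≤ 1` and `u ≠ 0`. -/
noncomputable def rayExit (x u : E) : ℝ :=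
  (-inner ℝ x u + √(inner ℝ x u ^ 2 + ‖u‖ ^ 2 * (1 - ‖x‖ ^ 2))) / ‖u‖ ^ 2

theorem norm_add_rayExit_smul {x u : E} (hx : ‖x‖ ≤ 1) (hu : u ≠ 0) :
    ‖x + rayExit x u • u‖ = 1 := by
  have hu2 : ‖u‖ ^ 2 ≠ 0 := by simpa using hu
  have hdisc : 0 ≤ inner ℝ x u ^ 2 + ‖u‖ ^ 2 * (1 - ‖x‖ ^ 2) := by
    have : ‖x‖ ^ 2 ≤ 1 := pow_le_one₀ (norm_nonneg x) hx
    have : 0 ≤ 1 - ‖x‖ ^ 2 := sub_nonneg.2 this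
    positivity
  have hroot : rayExit x u * ‖u‖ ^ 2 =
      -inner ℝ x u + √(inner ℝ x u ^ 2 + ‖u‖ ^ 2 * (1 - ‖x‖ ^ 2)) := div_mul_cancel₀ _ hu2
  have hexpand : ‖x + rayExit x u • u‖ ^ 2 =
      ‖x‖ ^ 2 + 2 * (rayExit x u * inner ℝ x u) + rayExit x u ^ 2 * ‖u‖ ^ 2 := by
    rw [norm_add_sq_real, inner_smul_right, norm_smul, mul_pow, Real.norm_eq_abs, sq_abs]
  have hsq : ‖u‖ ^ 2 * ‖x + rayExit x u • u‖ ^ 2 = ‖u‖ ^ 2 * 1 := by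
    rw [hexpand]
    linear_combination (rayExit x u * ‖u‖ ^ 2 + inner ℝ x u +
      √(inner ℝ x u ^ 2 + ‖u‖ ^ 2 * (1 - ‖x‖ ^ 2))) * hroot + Real.sq_sqrt hdisc
  exact (pow_eq_one_iff_of_nonneg (norm_nonneg _) two_ne_zero).1 (mul_left_cancel₀ hu2 hsq)

theorem rayExit_eq_zero {x u : E} (hx : ‖x‖ = 1) (hxu : 0 ≤ inner ℝ x u) : rayExit x u = 0 := by
  simp [rayExit, hx, Real.sqrt_sq hxu]

theorem contDiffAt_rayExit {F : Type*} [NormedAddCommGroup F] [NormedSpace ℝ F] {n : WithTop ℕ∞}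
    {x u : F → E} {a : F} (hx : ContDiffAt ℝ n x a) (hu : ContDiffAt ℝ n u a) (hua : u a ≠ 0)
    (hdisc : inner ℝ (x a) (u a) ^ 2 + ‖u a‖ ^ 2 * (1 - ‖x a‖ ^ 2) ≠ 0) :
    ContDiffAt ℝ n (fun z => rayExit (x z) (u z)) a := by
  have hinner := hx.inner ℝ hu
  have hunorm := hu.norm_sq ℝ
  refine (hinner.neg.add (ContDiffAt.sqrt ?_ hdisc)).div hunorm (by simpa using hua)
  exact (hinner.pow 2).add (hunorm.mul (contDiffAt_const.sub (hx.norm_sq ℝ)))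

theorem inner_sub_pos_of_norm_le_one {x y : E} (hx : ‖x‖ = 1) (hy : ‖y‖ ≤ 1) (hne : y ≠ x) :
    0 < inner ℝ x (x - y) := by
  have hlt : inner ℝ x y < 1 := by
    have hexpand := norm_sub_sq_real x y
    have hpos : 0 < ‖x - y‖ := norm_sub_pos_iff.2 hne.symm
    have hy2 : ‖y‖ ^ 2 ≤ 1 := pow_le_one₀ (norm_nonneg y) hy
    rw [hx] at hexpand
    nlinarith
  rw [inner_sub_right, real_inner_self_eq_norm_sq, hx]
  linarith

theorem exists_fixedPoint_of_contDiff_of_mapsTo_unitBall [FiniteDimensional ℝ E] {f : E → E}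
    (hf : ContDiff ℝ 1 f) (hmaps : MapsTo f (closedBall 0 1) (closedBall 0 1)) :
    ∃ x, f x = x := by
  by_contra! hne
  have hdir : ∀ x, x - f x ≠ 0 := fun x => sub_ne_zero.2 (hne x).symm
  have hinner : ∀ x, ‖x‖ = 1 → 0 < inner ℝ x (x - f x) := fun x hx =>
    inner_sub_pos_of_norm_le_one hx
      (mem_closedBall_zero_iff.1 (hmaps (mem_closedBall_zero_iff.2 hx.le))) (hne x)
  refine not_exists_contDiff_retraction_sphere (E := E)
    ⟨fun x => x + rayExit x (x - f x) • (x - f x), fun x hx => ?_, fun x hx => ?_, fun x hx => ?_⟩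
  · have hu : ContDiffAt ℝ 1 (fun x => x - f x) x := contDiffAt_id.sub hf.contDiffAt
    refine contDiffAt_id.add ((contDiffAt_rayExit contDiffAt_id hu (hdir x) ?_).smul hu)
    rcases (mem_closedBall_zero_iff.1 hx).lt_or_eq with hlt | heq
    · have hx2 : 0 < 1 - ‖x‖ ^ 2 := sub_pos.2 (pow_lt_one₀ (norm_nonneg x) hlt two_ne_zero)
      have hu2 : 0 < ‖x - f x‖ := norm_pos_iff.2 (hdir x)
      exact (by positivity : 0 < inner ℝ x (x - f x) ^ 2 + ‖x - f x‖ ^ 2 * (1 - ‖x‖ ^ 2)).ne'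
    · simpa [heq] using (hinner x heq).ne'
  · have hx1 : ‖x‖ = 1 := mem_sphere_zero_iff_norm.1 hx
    simp only [rayExit_eq_zero hx1 (hinner x hx1).le, zero_smul, add_zero]
  · exact mem_sphere_zero_iff_norm.2
      (norm_add_rayExit_smul (mem_closedBall_zero_iff.1 hx) (hdir x))

theorem exists_fixedPoint_of_contDiff_of_norm_le [FiniteDimensional ℝ E] {f : E → E} {R : ℝ}
    (hf : ContDiff ℝ 1 f) (hR : ∀ x, ‖f x‖ ≤ R) : ∃ x, f x = x := by
  let r := max R 1
  have hr : 0 < r := lt_max_of_lt_right one_pos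
  obtain ⟨x, hx⟩ := exists_fixedPoint_of_contDiff_of_mapsTo_unitBall
    (f := fun x => r⁻¹ • f (r • x)) (contDiff_const.smul (hf.comp (contDiff_const_smul r)))
    fun x _ => by
      rw [mem_closedBall_zero_iff, norm_smul, norm_inv, Real.norm_of_nonneg hr.le,
        inv_mul_le_one₀ hr]
      exact (hR _).trans (le_max_left R 1)
  exact ⟨r • x, (inv_smul_eq_iff₀ hr.ne').1 hx⟩

theorem exists_fixedPoint_of_continuous_of_norm_le [FiniteDimensional ℝ E] {f : E → E} {R : ℝ}
    (hf : Continuous f) (hR : ∀ x, ‖f x‖ ≤ R) : ∃ x, f x = x := by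
  by_contra! hne
  obtain ⟨g, hg, hgf, -⟩ := hf.exists_contDiff_approx 1 (ε := fun x => min 1 ‖f x - x‖)
    (by fun_prop) fun x => lt_min one_pos (norm_sub_pos_iff.2 (hne x))
  obtain ⟨x, hx⟩ := exists_fixedPoint_of_contDiff_of_norm_le (R := R + 1) hg fun x =>
    calc ‖g x‖ ≤ ‖f x‖ + ‖g x - f x‖ := norm_le_norm_add_norm_sub' _ _
      _ ≤ R + 1 := add_le_add (hR x) <|
        dist_eq_norm (g x) (f x) ▸ ((hgf x).trans_le (min_le_left _ _)).le
  have hlt : dist (g x) (f x) < ‖f x - x‖ := (hgf x).trans_le (min_le_right _ _)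
  rw [hx, dist_comm, dist_eq_norm] at hlt
  exact lt_irrefl _ hlt

end InnerProductSpace

theorem exists_fixedPoint_of_continuous_of_isBounded_range {E : Type*} [NormedAddCommGroup E]
    [NormedSpace ℝ E] [FiniteDimensional ℝ E] {f : E → E} (hf : Continuous f)
    (hbdd : Bornology.IsBounded (range f)) : ∃ x, f x = x := by
  let e : E ≃L[ℝ] EuclideanSpace ℝ (Fin (Module.finrank ℝ E)) := toEuclidean
  obtain ⟨R, hR⟩ := (e.lipschitz.isBounded_image hbdd).exists_norm_le
  obtain ⟨y, hy⟩ := exists_fixedPoint_of_continuous_of_norm_le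
    (f := fun y => e (f (e.symm y))) (by fun_prop)
    fun y => hR _ (mem_image_of_mem e (mem_range_self _))
  exact ⟨e.symm y, by rw [e.eq_symm_apply, hy]⟩

theorem exists_forall_nonneg_of_isCompact_of_convex {E : Type*} [NormedAddCommGroup E]
    [NormedSpace ℝ E] [FiniteDimensional ℝ E] {K : Set E} (hconv : Convex ℝ K) (hK : IsCompact K)
    (hne : K.Nonempty) {F : E → E → ℝ} (husc : ∀ y ∈ K, UpperSemicontinuousOn (fun x => F x y) K)
    (hF : ∀ x ∈ K, QuasiconvexOn ℝ K (F x)) (hdiag : ∀ x ∈ K, 0 ≤ F x x) :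
    ∃ x ∈ K, ∀ y ∈ K, 0 ≤ F x y := by
  by_contra! hneg
  obtain ⟨y₀, hy₀⟩ := hne
  have hlocal : ∀ x, ∃ y, ∀ᶠ z in nhds x, y ∈ {y ∈ K | z ∈ K → F z y < 0} := by
    intro x
    by_cases hx : x ∈ K
    · obtain ⟨y, hy, hxy⟩ := hneg x hx
      refine ⟨y, ?_⟩
      filter_upwards [eventually_nhdsWithin_iff.1 (husc y hy x hx 0 hxy)] with z hz using ⟨hy, hz⟩
    · refine ⟨y₀, ?_⟩
      filter_upwards [hK.isClosed.isOpen_compl.mem_nhds hx] with z hz using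
        ⟨hy₀, fun hzK => absurd hzK hz⟩
  have hconvex : ∀ x, Convex ℝ {y ∈ K | x ∈ K → F x y < 0} := by
    intro x
    by_cases hx : x ∈ K
    · simpa only [hx, true_imp_iff] using (hF x hx).convex_lt 0
    · convert hconv using 1
      exact sep_eq_self_iff_mem_true.2 fun y _ hxK => absurd hxK hx
  obtain ⟨g, hg⟩ := exists_continuous_forall_mem_convex_of_local_const hconvex hlocal
  obtain ⟨x, hx⟩ := exists_fixedPoint_of_continuous_of_isBounded_range g.continuous
    (hK.isBounded.subset (range_subset_iff.2 fun x => (hg x).1))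
  have hxK : x ∈ K := hx ▸ (hg x).1
  have hlt : F x (g x) < 0 := (hg x).2 hxK
  rw [hx] at hlt
  exact (hdiag x hxK).not_gt hlt

end Brouwer

section SublevelSets

open Filter Set

theorem isClosed_sep_le {α : Type*} [TopologicalSpace α] {s : Set α} {f : α → ℝ}
    (hs : IsClosed s) (hf : LowerSemicontinuousOn f s) (r : ℝ) : IsClosed {x ∈ s | f x ≤ r} := by
  obtain ⟨v, hv, hsv⟩ := lowerSemicontinuousOn_iff_preimage_Iic.1 hf r
  have hsep : {x ∈ s | f x ≤ r} = s ∩ v := hsv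
  exact hsep ▸ hs.inter hv

theorem exists_lt_forall_le_of_isCompact {α : Type*} [TopologicalSpace α] {s : Set α} {f : α → ℝ}
    {r : ℝ} (hs : IsCompact s) (hf : LowerSemicontinuousOn f s) (hr : ∀ x ∈ s, r < f x) :
    ∃ c, r < c ∧ ∀ x ∈ s, c ≤ f x := by
  rcases s.eq_empty_or_nonempty with rfl | hne
  · exact ⟨r + 1, lt_add_one r, fun x hx => hx.elim⟩
  · obtain ⟨a, ha, hmin⟩ := hf.exists_isMinOn hne hs
    exact ⟨f a, hr a ha, hmin⟩

theorem norm_sub_mul_le_of_convexOn {E : Type*} [NormedAddCommGroup E] [NormedSpace ℝ E]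
    {s : Set E} {f : E → ℝ} (hf : ConvexOn ℝ s f) {x₀ x : E} (hx₀ : x₀ ∈ s) (hx : x ∈ s)
    {R c : ℝ} (hR : 0 < R) (hxR : R ≤ ‖x - x₀‖) (hc : ∀ z ∈ s, ‖z - x₀‖ = R → c ≤ f z) :
    ‖x - x₀‖ * (c - f x₀) ≤ R * (f x - f x₀) := by
  have hpos : 0 < ‖x - x₀‖ := hR.trans_le hxR
  let a := R / ‖x - x₀‖
  have ha0 : 0 ≤ a := by positivity
  have ha1 : 0 ≤ 1 - a := sub_nonneg.2 ((div_le_one hpos).2 hxR)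
  have hnorm : ‖(1 - a) • x₀ + a • x - x₀‖ = R := by
    rw [show (1 - a) • x₀ + a • x - x₀ = a • (x - x₀) by module, norm_smul,
      Real.norm_of_nonneg ha0, div_mul_cancel₀ _ hpos.ne']
  have hle : c ≤ (1 - a) * f x₀ + a * f x :=
    (hc _ (hf.1 hx₀ hx ha1 ha0 (sub_add_cancel 1 a)) hnorm).trans
      (hf.2 hx₀ hx ha1 ha0 (sub_add_cancel 1 a))
  have haR : ‖x - x₀‖ * a = R := mul_div_cancel₀ R hpos.ne'
  calc ‖x - x₀‖ * (c - f x₀) ≤ ‖x - x₀‖ * (a * (f x - f x₀)) := by gcongr; linarith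
    _ = R * (f x - f x₀) := by rw [← mul_assoc, haR]

theorem isBounded_sep_le_of_convexOn {E : Type*} [NormedAddCommGroup E] [NormedSpace ℝ E]
    [FiniteDimensional ℝ E] {s : Set E} {f : E → ℝ} (hs : IsClosed s) (hf : ConvexOn ℝ s f)
    (hlsc : LowerSemicontinuousOn f s) {r : ℝ} (hne : {x ∈ s | f x ≤ r}.Nonempty)
    (hbdd : Bornology.IsBounded {x ∈ s | f x ≤ r}) (r' : ℝ) :
    Bornology.IsBounded {x ∈ s | f x ≤ r'} := by
  obtain ⟨x₀, hx₀, hx₀r⟩ := hne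
  obtain ⟨R, hR, hball⟩ := hbdd.subset_ball_lt 0 x₀
  have hsphere : ∀ x ∈ s ∩ Metric.sphere x₀ R, r < f x := by
    rintro x ⟨hx, hxR⟩
    by_contra! hxr
    exact (Metric.mem_ball.1 (hball ⟨hx, hxr⟩)).ne hxR
  obtain ⟨c, hrc, hc⟩ := exists_lt_forall_le_of_isCompact ((isCompact_sphere x₀ R).inter_left hs)
    (hlsc.mono inter_subset_left) hsphere
  have hpos : 0 < c - f x₀ := sub_pos.2 (hx₀r.trans_lt hrc)
  refine (Metric.isBounded_iff_subset_closedBall x₀).2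
    ⟨max R (R * (r' - f x₀) / (c - f x₀)), fun x ⟨hx, hxr'⟩ => ?_⟩
  rw [mem_closedBall_iff_norm, le_max_iff, le_div_iff₀ hpos]
  refine (le_total ‖x - x₀‖ R).imp_right fun hxR => ?_
  calc ‖x - x₀‖ * (c - f x₀) ≤ R * (f x - f x₀) :=
        norm_sub_mul_le_of_convexOn hf hx₀ hx hR hxR fun z hz hzR =>
          hc z ⟨hz, mem_sphere_iff_norm.2 hzR⟩
    _ ≤ R * (r' - f x₀) := by gcongr

theorem isCompact_sep_le_of_convexOn {E : Type*} [NormedAddCommGroup E] [NormedSpace ℝ E]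
    [FiniteDimensional ℝ E] {s : Set E} {f : E → ℝ} (hs : IsClosed s) (hf : ConvexOn ℝ s f)
    (hlsc : LowerSemicontinuousOn f s)
    (hbdd : ∃ r, {x ∈ s | f x ≤ r}.Nonempty ∧ Bornology.IsBounded {x ∈ s | f x ≤ r}) (r' : ℝ) :
    IsCompact {x ∈ s | f x ≤ r'} := by
  obtain ⟨r, hne, hr⟩ := hbdd
  exact Metric.isCompact_of_isClosed_isBounded (isClosed_sep_le hs hlsc r')
    (isBounded_sep_le_of_convexOn hs hf hlsc hne hr r')

theorem exists_convexComb_le_of_lt {a b c : ℝ} (hac : a < c) :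
    ∃ t ∈ Ioc (0 : ℝ) 1, (1 - t) * a + t * b ≤ c := by
  have hcont : Continuous fun t : ℝ => (1 - t) * a + t * b := by fun_prop
  have hlt : ∀ᶠ t in nhdsWithin (0 : ℝ) (Ioi 0), (1 - t) * a + t * b < c :=
    (hcont.continuousWithinAt.tendsto).eventually_lt_const (by simpa using hac)
  obtain ⟨t, htc, ht⟩ := (hlt.and (Ioc_mem_nhdsGT zero_lt_one)).exists
  exact ⟨t, ht, htc.le⟩

end SublevelSets

section EquilibriumProblem

open Filter Set

/-- `x` solves the equilibrium problem for the bifunction `Φ` on `K`. -/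
def IsEquilibriumPoint {W : Type*} (K : Set W) (Φ : W → W → ℝ) (x : W) : Prop :=
  x ∈ K ∧ ∀ y ∈ K, 0 ≤ Φ x y

/-- The bifunction `Φ` with the exterior penalty `P` of weight `t` added. Both values of `P` enter,
so that the diagonal values are those of `Φ`. -/
def penalized {W : Type*} (Φ : W → W → ℝ) (P : W → ℝ) (t : ℝ) (x y : W) : ℝ :=
  Φ x y + t * (P y - P x)

/-- The points of `K` that the penalty `P` does not penalize. -/
def penaltyZeros {W : Type*} (K : Set W) (P : W → ℝ) : Set W := {x ∈ K | P x = 0}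

theorem IsEquilibriumPoint.mul_penalty_le {W : Type*} {K : Set W} {Φ : W → W → ℝ} {P : W → ℝ}
    {t : ℝ} {x y : W} (hx : IsEquilibriumPoint K (penalized Φ P t) x) (hy : y ∈ penaltyZeros K P) :
    t * P x ≤ Φ x y := by
  have hnonneg := hx.2 y hy.1
  simp only [penalized, hy.2] at hnonneg
  linarith

theorem frequently_of_mapClusterPt_of_nhdsWithin {α X : Type*} [TopologicalSpace X] {l : Filter α}
    {u : α → X} {a : X} {s : Set X} {p : X → Prop} (ha : MapClusterPt a l u)
    (hu : ∀ᶠ k in l, u k ∈ s) (hp : ∀ᶠ z in nhdsWithin a s, p z) : ∃ᶠ k in l, p (u k) :=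
  ((ha.frequently (eventually_nhdsWithin_iff.1 hp)).and_eventually hu).mono
    fun _ hk => hk.1 hk.2

section TopologicalSpace

variable {W : Type*} [AddCommGroup W] [Module ℝ W] [TopologicalSpace W] {K : Set W}
  {Φ : W → W → ℝ} {P μ : W → ℝ} {r t : ℝ} {x : W}

/-- Equilibrium problems on a closed convex set whose bifunction is upper semicontinuous in the
first variable, convex in the second and zero on the diagonal. -/
structure IsConvexEquilibriumProblem (K : Set W) (Φ : W → W → ℝ) : Prop where
  convex : Convex ℝ K
  isClosed : IsClosed K
  upperSemicontinuousOn : ∀ y ∈ K, UpperSemicontinuousOn (fun x => Φ x y) K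
  convexOn : ∀ x ∈ K, ConvexOn ℝ K (Φ x)
  self_eq_zero : ∀ x ∈ K, Φ x x = 0

/-- Convex exterior penalties on `K`; the constraint they stand for is `penaltyZeros K P`. -/
structure IsExteriorPenalty (K : Set W) (P : W → ℝ) : Prop where
  convexOn : ConvexOn ℝ K P
  lowerSemicontinuousOn : LowerSemicontinuousOn P K
  nonneg : ∀ x ∈ K, 0 ≤ P x

theorem IsConvexEquilibriumProblem.penalized (hΦ : IsConvexEquilibriumProblem K Φ)
    (hP : IsExteriorPenalty K P) (ht : 0 ≤ t) : IsConvexEquilibriumProblem K (penalized Φ P t) where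
  convex := hΦ.convex
  isClosed := hΦ.isClosed
  upperSemicontinuousOn y hy := by
    refine (hΦ.upperSemicontinuousOn y hy).add ?_
    intro x hx
    have hcont : Continuous fun p : ℝ => t * (P y - p) := by fun_prop
    exact hcont.continuousAt.comp_lowerSemicontinuousWithinAt_antitone
      (hP.lowerSemicontinuousOn x hx) fun p q hpq =>
        mul_le_mul_of_nonneg_left (sub_le_sub_left hpq _) ht
  convexOn x hx := (hΦ.convexOn x hx).add <|
    (hP.convexOn.sub (concaveOn_const (P x) hP.convexOn.1)).smul ht
  self_eq_zero x hx := by simp [_root_.penalized, hΦ.self_eq_zero x hx]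

theorem IsConvexEquilibriumProblem.isEquilibriumPoint_of_sep_le
    (hΦ : IsConvexEquilibriumProblem K Φ) (hμ : ConvexOn ℝ K μ)
    (hx : IsEquilibriumPoint {x ∈ K | μ x ≤ r} Φ x) (hxr : μ x < r) : IsEquilibriumPoint K Φ x := by
  obtain ⟨⟨hxK, -⟩, hxnonneg⟩ := hx
  refine ⟨hxK, fun y hy => ?_⟩
  obtain ⟨a, ⟨ha0, ha1⟩, har⟩ := exists_convexComb_le_of_lt (b := μ y) hxr
  have ha1' : 0 ≤ 1 - a := sub_nonneg.2 ha1
  have hmem : (1 - a) • x + a • y ∈ {x ∈ K | μ x ≤ r} :=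
    ⟨hΦ.convex hxK hy ha1' ha0.le (sub_add_cancel 1 a),
      (hμ.2 hxK hy ha1' ha0.le (sub_add_cancel 1 a)).trans har⟩
  have hnonneg : 0 ≤ a * Φ x y :=
    calc 0 ≤ Φ x ((1 - a) • x + a • y) := hxnonneg _ hmem
      _ ≤ (1 - a) • Φ x x + a • Φ x y :=
        (hΦ.convexOn x hxK).2 hxK hy ha1' ha0.le (sub_add_cancel 1 a)
      _ = a * Φ x y := by rw [hΦ.self_eq_zero x hxK, smul_zero, zero_add, smul_eq_mul]
  exact nonneg_of_mul_nonneg_right hnonneg ha0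

theorem isEquilibriumPoint_penaltyZeros_of_mapClusterPt {ι : Type*} {l : Filter ι} {τ : ι → ℝ}
    {w : ι → W} (hΦ : IsConvexEquilibriumProblem K Φ) (hP : IsExteriorPenalty K P)
    (hne : (penaltyZeros K P).Nonempty) (hτ : Tendsto τ l atTop)
    (hw : ∀ᶠ k in l, IsEquilibriumPoint K (penalized Φ P (τ k)) (w k)) (hx : MapClusterPt x l w) :
    IsEquilibriumPoint (penaltyZeros K P) Φ x := by
  have hwK : ∀ᶠ k in l, w k ∈ K := hw.mono fun k hk => hk.1
  have hxK : x ∈ K := hΦ.isClosed.mem_of_mapClusterPt hx hwK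
  have hPx : P x = 0 := by
    by_contra hPx
    have hpos : 0 < P x := (hP.nonneg x hxK).lt_of_ne' hPx
    obtain ⟨y, hy⟩ := hne
    have hnhds : ∀ᶠ z in nhdsWithin x K, P x / 2 < P z ∧ Φ z y < Φ x y + 1 :=
      (hP.lowerSemicontinuousOn x hxK _ (half_lt_self hpos)).and
        (hΦ.upperSemicontinuousOn y hy.1 x hxK _ (lt_add_one _))
    have hlarge : ∀ᶠ k in l, Φ x y + 1 ≤ τ k * (P x / 2) :=
      (hτ.atTop_mul_const (half_pos hpos)).eventually_ge_atTop _
    obtain ⟨k, ⟨hPk, hΦk⟩, hwk, hk, hk0⟩ :=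
      ((frequently_of_mapClusterPt_of_nhdsWithin hx hwK hnhds).and_eventually
        (hw.and (hlarge.and (hτ.eventually_ge_atTop 0)))).exists
    refine lt_irrefl (Φ x y + 1) ?_
    calc Φ x y + 1 ≤ τ k * (P x / 2) := hk
      _ ≤ τ k * P (w k) := by gcongr
      _ ≤ Φ (w k) y := hwk.mul_penalty_le hy
      _ < Φ x y + 1 := hΦk
  refine ⟨⟨hxK, hPx⟩, fun y hy => ?_⟩
  by_contra! hneg
  obtain ⟨k, hk, hwk, hk0⟩ := ((frequently_of_mapClusterPt_of_nhdsWithin hx hwK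
    (hΦ.upperSemicontinuousOn y hy.1 x hxK 0 hneg)).and_eventually
      (hw.and (hτ.eventually_ge_atTop 0))).exists
  exact hk.not_ge ((mul_nonneg hk0 (hP.nonneg _ hwk.1)).trans (hwk.mul_penalty_le hy))

end TopologicalSpace

section NormedSpace

variable {W : Type*} [NormedAddCommGroup W] [NormedSpace ℝ W] {K D : Set W} {Φ : W → W → ℝ}
  {P μ : W → ℝ} {r t : ℝ} {x : W}

/-- Coercivity of a bifunction relative to a weakly coercive convex function `μ`: outside the
sublevel set `μ ≤ r` there is a direction of descent towards a point of `D` that does not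
increase `μ`. -/
structure DescentCoercive (K D : Set W) (Φ : W → W → ℝ) (μ : W → ℝ) (r : ℝ) : Prop where
  convexOn : ConvexOn ℝ K μ
  lowerSemicontinuousOn : LowerSemicontinuousOn μ K
  exists_isBounded : ∃ ρ, {x ∈ K | μ x ≤ ρ}.Nonempty ∧ Bornology.IsBounded {x ∈ K | μ x ≤ ρ}
  descent : ∀ x ∈ K, r < μ x → ∃ z ∈ D, μ z ≤ μ x ∧ Φ x z < 0

theorem DescentCoercive.penalized (hμ : DescentCoercive K (penaltyZeros K P) Φ μ r)
    (hP : IsExteriorPenalty K P) (ht : 0 ≤ t) : DescentCoercive K K (penalized Φ P t) μ r where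
  convexOn := hμ.convexOn
  lowerSemicontinuousOn := hμ.lowerSemicontinuousOn
  exists_isBounded := hμ.exists_isBounded
  descent x hx hxr := by
    obtain ⟨z, ⟨hz, hPz⟩, hzx, hneg⟩ := hμ.descent x hx hxr
    refine ⟨z, hz, hzx, ?_⟩
    have := mul_nonneg ht (hP.nonneg x hx)
    simp only [_root_.penalized, hPz]
    linarith

theorem DescentCoercive.le_of_forall_nonneg (hμ : DescentCoercive K D Φ μ r) (hx : x ∈ K)
    (hnonneg : ∀ z ∈ D, μ z ≤ μ x → 0 ≤ Φ x z) : μ x ≤ r := by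
  by_contra! hxr
  obtain ⟨z, hz, hzx, hneg⟩ := hμ.descent x hx hxr
  exact hneg.not_ge (hnonneg z hz hzx)

theorem DescentCoercive.le_of_isEquilibriumPoint (hμ : DescentCoercive K K Φ μ r)
    (hx : IsEquilibriumPoint K Φ x) : μ x ≤ r :=
  hμ.le_of_forall_nonneg hx.1 fun z hz _ => hx.2 z hz

theorem DescentCoercive.isCompact_sep_le [FiniteDimensional ℝ W] (hμ : DescentCoercive K D Φ μ r)
    (hK : IsClosed K) (ρ : ℝ) : IsCompact {x ∈ K | μ x ≤ ρ} :=
  isCompact_sep_le_of_convexOn hK hμ.convexOn hμ.lowerSemicontinuousOn hμ.exists_isBounded ρ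

theorem IsConvexEquilibriumProblem.exists_isEquilibriumPoint [FiniteDimensional ℝ W]
    (hΦ : IsConvexEquilibriumProblem K Φ) (hμ : DescentCoercive K K Φ μ r) :
    ∃ x, IsEquilibriumPoint K Φ x := by
  obtain ⟨-, ⟨x₀, hx₀, -⟩, -⟩ := hμ.exists_isBounded
  let ρ := max (μ x₀) (r + 1)
  have hsub : {x ∈ K | μ x ≤ ρ} ⊆ K := sep_subset K _
  obtain ⟨x, hx, hxnonneg⟩ := exists_forall_nonneg_of_isCompact_of_convex (hμ.convexOn.convex_le ρ)
    (hμ.isCompact_sep_le hΦ.isClosed ρ) ⟨x₀, hx₀, le_max_left _ _⟩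
    (fun y hy => (hΦ.upperSemicontinuousOn y hy.1).mono hsub)
    (fun x hx => ((hΦ.convexOn x hx.1).subset hsub (hμ.convexOn.convex_le ρ)).quasiconvexOn)
    fun x hx => (hΦ.self_eq_zero x hx.1).ge
  have hxr : μ x ≤ r := hμ.le_of_forall_nonneg hx.1 fun z hz hzx =>
    hxnonneg z ⟨hz, hzx.trans hx.2⟩
  exact ⟨x, hΦ.isEquilibriumPoint_of_sep_le hμ.convexOn ⟨hx, hxnonneg⟩
    (hxr.trans_lt ((lt_add_one r).trans_le (le_max_right _ _)))⟩

theorem eventually_mem_sep_le_of_isEquilibriumPoint_penalized {ι : Type*} {l : Filter ι}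
    {τ : ι → ℝ} {w : ι → W} (hP : IsExteriorPenalty K P)
    (hμ : DescentCoercive K (penaltyZeros K P) Φ μ r) (hτ : Tendsto τ l atTop)
    (hw : ∀ᶠ k in l, IsEquilibriumPoint K (penalized Φ P (τ k)) (w k)) :
    ∀ᶠ k in l, w k ∈ {x ∈ K | μ x ≤ r} := by
  filter_upwards [hw, hτ.eventually_ge_atTop 0] with k hk hk0
  exact ⟨hk.1, (hμ.penalized hP hk0).le_of_isEquilibriumPoint hk⟩

end NormedSpace

end EquilibriumProblem

theorem convexOn_finsetSum {ι E : Type*} [AddCommGroup E] [Module ℝ E] {s : Set E}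
    (hs : Convex ℝ s) (t : Finset ι) {f : ι → E → ℝ} (hf : ∀ i ∈ t, ConvexOn ℝ s (f i)) :
    ConvexOn ℝ s fun x => ∑ i ∈ t, f i x := by
  classical
  induction t using Finset.induction_on with
  | empty => simpa using convexOn_const 0 hs
  | insert i t hi ih =>
    simp only [Finset.sum_insert hi]
    exact (hf i (t.mem_insert_self i)).add (ih fun j hj => hf j (Finset.mem_insert_of_mem hj))

theorem IsPenaltyKernel.eq_zero_iff {m : ℕ} {φ : (Fin m → ℝ) → ℝ} (hφ : IsPenaltyKernel φ)
    (v : Fin m → ℝ) : φ v = 0 ↔ v ≤ 0 :=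
  ⟨fun hv => by_contra fun hle => (hφ.pos v hle).ne' hv, hφ.eq_zero v⟩

theorem IsPenaltyKernel.nonneg {m : ℕ} {φ : (Fin m → ℝ) → ℝ} (hφ : IsPenaltyKernel φ)
    (v : Fin m → ℝ) : 0 ≤ φ v := by
  by_cases hv : v ≤ 0
  · exact (hφ.eq_zero v hv).ge
  · exact (hφ.pos v hv).le

namespace JointGame

variable {l m : ℕ} {n : Fin l → ℕ} {G : JointGame l m n} {U₀ : Set (Shares l m)}
  {φ : (Fin m → ℝ) → ℝ} {μ : Profile n → ℝ} {r : ℝ}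

theorem update_mem_prodX {x y : Profile n} (hx : x ∈ G.prodX) (hy : y ∈ G.prodX) (i : Fin l) :
    Function.update x i (y i) ∈ G.prodX := by
  intro j
  rcases eq_or_ne j i with rfl | hji
  · simpa using hy j
  · simpa [hji] using hx j

theorem prodX_eq_pi (G : JointGame l m n) : G.prodX = Set.univ.pi G.X :=
  Set.ext fun _ => Set.mem_univ_pi.symm

namespace BasicAssumptions

theorem convex_prodX (hG : G.BasicAssumptions) : Convex ℝ G.prodX :=
  G.prodX_eq_pi ▸ convex_pi fun i _ => hG.convex_X i

theorem isClosed_prodX (hG : G.BasicAssumptions) : IsClosed G.prodX :=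
  G.prodX_eq_pi ▸ isClosed_set_pi fun i _ => hG.closed_X i

theorem continuousOn_Phi (hG : G.BasicAssumptions) {y : Profile n} (hy : y ∈ G.prodX) :
    ContinuousOn (fun x => G.Phi x y) G.prodX := by
  refine ContinuousOn.sub ?_ (continuousOn_finsetSum _ fun i _ => ?_)
  · simpa only [Psi, Function.update_eq_self] using
      continuousOn_finsetSum _ fun i _ => hG.continuous_f i
  · exact (hG.continuous_f i).comp (continuous_id.update i continuous_const).continuousOn
      fun x hx => update_mem_prodX hx hy i

theorem convexOn_Phi (hG : G.BasicAssumptions) {x : Profile n} (hx : x ∈ G.prodX) :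
    ConvexOn ℝ G.prodX (G.Phi x) := by
  have hsum : ConvexOn ℝ G.prodX fun y => ∑ i, -G.f i (Function.update x i (y i)) :=
    convexOn_finsetSum hG.convex_prodX _ fun i _ =>
      (((hG.concave_f i x hx).comp_linearMap
        (LinearMap.proj (φ := fun i => Fin (n i) → ℝ) i)).subset
        (fun y (hy : y ∈ G.prodX) => hy i) hG.convex_prodX).neg
  refine (hsum.add_const (G.Psi x x)).congr fun y _ => ?_
  simp only [Pi.add_apply, Finset.sum_neg_distrib, Phi, Psi]
  ring

theorem continuous_h (hG : G.BasicAssumptions) (i : Fin l) : Continuous (G.h i) :=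
  continuous_pi fun j => (hG.convex_h i j).locallyLipschitz.continuous

theorem continuous_penalty (hG : G.BasicAssumptions) (hφ : Continuous φ) :
    Continuous (G.penalty φ) :=
  continuous_finsetSum _ fun i _ => hφ.comp <|
    ((hG.continuous_h i).comp ((continuous_apply i).comp continuous_fst)).sub
      ((continuous_apply i).comp continuous_snd)

theorem convexOn_penalty (hG : G.BasicAssumptions) (hφ : ConvexOn ℝ Set.univ φ)
    (hmono : Monotone φ) : ConvexOn ℝ Set.univ (G.penalty φ) := by
  refine convexOn_finsetSum convex_univ _ fun i _ => ⟨convex_univ, ?_⟩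
  rintro ⟨x, u⟩ - ⟨y, v⟩ - a b ha hb hab
  have hle : G.h i (a • x i + b • y i) - (a • u i + b • v i) ≤
      a • (G.h i (x i) - u i) + b • (G.h i (y i) - v i) := by
    intro j
    have hconv := (hG.convex_h i j).2 (Set.mem_univ (x i)) (Set.mem_univ (y i)) ha hb hab
    simp only [Pi.sub_apply, Pi.add_apply, Pi.smul_apply, smul_eq_mul] at hconv ⊢
    linarith
  exact (hmono hle).trans (hφ.2 (Set.mem_univ _) (Set.mem_univ _) ha hb hab)

theorem isConvexEquilibriumProblem (hG : G.BasicAssumptions) (hU : G.AdmissibleShares U₀) :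
    IsConvexEquilibriumProblem (G.prodX ×ˢ G.shareSet U₀) fun w w' => G.Phi w.1 w'.1 where
  convex := hG.convex_prodX.prod hU.convex
  isClosed := hG.isClosed_prodX.prod hU.closed
  upperSemicontinuousOn _ hw :=
    ((hG.continuousOn_Phi hw.1).comp continuousOn_fst fun _ hw' => hw'.1).upperSemicontinuousOn
  convexOn _ hw := ((hG.convexOn_Phi hw.1).comp_linearMap (LinearMap.fst ℝ _ _)).subset
    (fun _ hw' => hw'.1) (hG.convex_prodX.prod hU.convex)
  self_eq_zero _ _ := sub_self _

theorem isExteriorPenalty (hG : G.BasicAssumptions) {K : Set (Profile n × Shares l m)}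
    (hK : Convex ℝ K) (hφ : ConvexOn ℝ Set.univ φ) (hmono : Monotone φ) (hnonneg : ∀ v, 0 ≤ φ v) :
    IsExteriorPenalty K (G.penalty φ) where
  convexOn := (hG.convexOn_penalty hφ hmono).subset (Set.subset_univ _) hK
  lowerSemicontinuousOn :=
    (hG.continuous_penalty hφ.locallyLipschitz.continuous).continuousOn.lowerSemicontinuousOn
  nonneg _ _ := Finset.sum_nonneg fun _ _ => hnonneg _

end BasicAssumptions

theorem penalty_eq_zero_iff (hnonneg : ∀ v, 0 ≤ φ v) (hzero : ∀ v, φ v = 0 ↔ v ≤ 0)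
    (w : Profile n × Shares l m) : G.penalty φ w = 0 ↔ ∀ i, G.h i (w.1 i) ≤ w.2 i := by
  simp only [penalty, Finset.sum_eq_zero_iff_of_nonneg fun _ _ => hnonneg _, hzero, sub_nonpos,
    Finset.mem_univ, true_imp_iff]

theorem image_fst_penaltyZeros (hU : G.AdmissibleShares U₀) (hnonneg : ∀ v, 0 ≤ φ v)
    (hzero : ∀ v, φ v = 0 ↔ v ≤ 0) :
    Prod.fst '' penaltyZeros (G.prodX ×ˢ G.shareSet U₀) (G.penalty φ) = G.feasible := by
  ext x
  constructor
  · rintro ⟨w, ⟨hw, hPw⟩, rfl⟩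
    refine ⟨hw.1, ?_⟩
    calc ∑ i, G.h i (w.1 i) ≤ ∑ i, w.2 i :=
          Finset.sum_le_sum fun i _ => (penalty_eq_zero_iff hnonneg hzero w).1 hPw i
      _ = G.b := hw.2.2
  · intro hx
    obtain ⟨u, hu, hhu⟩ := hU.covers x hx
    exact ⟨(x, u), ⟨⟨hx.1, hu⟩, (penalty_eq_zero_iff hnonneg hzero _).2 hhu⟩, rfl⟩

theorem isNormalizedEquilibrium_of_isEquilibriumPoint {Z : Set (Profile n × Shares l m)}
    (hZ : Prod.fst '' Z = G.feasible) {w : Profile n × Shares l m}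
    (hw : IsEquilibriumPoint Z (fun w w' => G.Phi w.1 w'.1) w) :
    G.IsNormalizedEquilibrium w.1 := by
  refine ⟨hZ ▸ Set.mem_image_of_mem _ hw.1, fun y hy => ?_⟩
  obtain ⟨w', hw', rfl⟩ := hZ ▸ hy
  exact hw.2 w' hw'

theorem Coercivity.descentCoercive (hC : G.Coercivity μ r) (hU : Convex ℝ (G.shareSet U₀))
    (hUne : (G.shareSet U₀).Nonempty) (hUb : Bornology.IsBounded (G.shareSet U₀))
    {Z : Set (Profile n × Shares l m)} (hZ : G.feasible ⊆ Prod.fst '' Z) :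
    DescentCoercive (G.prodX ×ˢ G.shareSet U₀) Z (fun w w' => G.Phi w.1 w'.1)
      (fun w => μ w.1) r where
  convexOn := (hC.convex.comp_linearMap (LinearMap.fst ℝ _ _)).subset (fun _ hw => hw.1)
    (hC.convex.1.prod hU)
  lowerSemicontinuousOn :=
    hC.lsc.comp continuousOn_fst fun _ hw => hw.1
  exists_isBounded := by
    obtain ⟨ρ, ⟨x, hx, hxρ⟩, hb⟩ := hC.weaklyCoercive
    obtain ⟨u, hu⟩ := hUne
    exact ⟨ρ, ⟨(x, u), ⟨hx, hu⟩, hxρ⟩, (hb.prod hUb).subset fun w hw => ⟨⟨hw.1.1, hw.2⟩, hw.1.2⟩⟩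
  descent w hw hwr := by
    obtain ⟨z, hz, hzw, hneg⟩ := hC.descent w.1 ⟨hw.1, fun hwB => hwr.not_ge hwB.2⟩
    obtain ⟨w', hw', rfl⟩ := hZ hz
    exact ⟨w', hw', hzw, hneg⟩

theorem mem_and_isNormalizedEquilibrium_of_mapClusterPt
    (hΦ : IsConvexEquilibriumProblem (G.prodX ×ˢ G.shareSet U₀) fun w w' => G.Phi w.1 w'.1)
    (hP : IsExteriorPenalty (G.prodX ×ˢ G.shareSet U₀) (G.penalty φ))
    (hμ : DescentCoercive (G.prodX ×ˢ G.shareSet U₀)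
      (penaltyZeros (G.prodX ×ˢ G.shareSet U₀) (G.penalty φ)) (fun w w' => G.Phi w.1 w'.1)
      (fun w => μ w.1) r)
    (hne : G.feasible.Nonempty)
    (hZ : Prod.fst '' penaltyZeros (G.prodX ×ˢ G.shareSet U₀) (G.penalty φ) = G.feasible)
    {ι : Type*} {L : Filter ι} {τ : ι → ℝ} (hτ : Filter.Tendsto τ L Filter.atTop)
    {w : ι → Profile n × Shares l m}
    (hw : ∀ᶠ k in L, G.IsPenalizedSolution U₀ φ (τ k) (w k)) {w' : Profile n × Shares l m}
    (hw' : MapClusterPt w' L w) :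
    w' ∈ (G.levelSet μ r ∩ G.feasible) ×ˢ G.shareSet U₀ ∧ G.IsNormalizedEquilibrium w'.1 := by
  have hmem := (hμ.isCompact_sep_le hΦ.isClosed r).isClosed.mem_of_mapClusterPt hw'
    (eventually_mem_sep_le_of_isEquilibriumPoint_penalized hP hμ hτ hw)
  have heq : G.IsNormalizedEquilibrium w'.1 := isNormalizedEquilibrium_of_isEquilibriumPoint hZ
    (isEquilibriumPoint_penaltyZeros_of_mapClusterPt hΦ hP (Set.image_nonempty.1 (hZ.symm ▸ hne))
      hτ hw hw')
  exact ⟨⟨⟨⟨hmem.1.1, hmem.2⟩, heq.1⟩, hmem.1.2⟩, heq⟩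

end JointGame

theorem theorem4p1_general {l m : ℕ} {n : Fin l → ℕ} (G : JointGame l m n)
    (hG : G.BasicAssumptions) (μ : Profile n → ℝ) (r : ℝ) (hC : G.Coercivity μ r)
    (U₀ : Set (Shares l m)) (hU : G.AdmissibleShares U₀)
    (hUb : Bornology.IsBounded (G.shareSet U₀)) (φ : (Fin m → ℝ) → ℝ)
    (hφ : ConvexOn ℝ Set.univ φ) (hmono : Monotone φ) (hnonneg : ∀ v, 0 ≤ φ v)
    (hzero : ∀ v, φ v = 0 ↔ v ≤ 0) {ι : Type*} (L : Filter ι) [L.NeBot] (τ : ι → ℝ)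
    (hτ : Filter.Tendsto τ L Filter.atTop) :
    (∃ x, G.IsNormalizedEquilibrium x) ∧
    (∀ t : ℝ, 0 ≤ t →
      (∃ w, G.IsPenalizedSolution U₀ φ t w) ∧
      ∀ w, G.IsPenalizedSolution U₀ φ t w → w ∈ G.levelSet μ r ×ˢ G.shareSet U₀) ∧
    (∀ w : ι → Profile n × Shares l m, (∀ᶠ k in L, G.IsPenalizedSolution U₀ φ (τ k) (w k)) →
      (∃ w', MapClusterPt w' L w) ∧
      ∀ w', MapClusterPt w' L w →
        w' ∈ (G.levelSet μ r ∩ G.feasible) ×ˢ G.shareSet U₀ ∧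
        G.IsNormalizedEquilibrium w'.1) := by
  have hZ := JointGame.image_fst_penaltyZeros hU hnonneg hzero
  have hne : (penaltyZeros (G.prodX ×ˢ G.shareSet U₀) (G.penalty φ)).Nonempty :=
    Set.image_nonempty.1 (hZ.symm ▸ hG.feasible_nonempty)
  have hΦ := hG.isConvexEquilibriumProblem hU
  have hP := hG.isExteriorPenalty hΦ.convex hφ hmono hnonneg
  have hμ := hC.descentCoercive hU.convex (hne.mono fun w hw => hw.1).snd hUb hZ.ge
  have hsol : ∀ t : ℝ, 0 ≤ t → ∃ w, G.IsPenalizedSolution U₀ φ t w := fun t ht =>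
    (hΦ.penalized hP ht).exists_isEquilibriumPoint (hμ.penalized hP ht)
  have hcluster : ∀ w : ι → Profile n × Shares l m,
      (∀ᶠ k in L, G.IsPenalizedSolution U₀ φ (τ k) (w k)) → ∃ w', MapClusterPt w' L w :=
    fun w hw => (hμ.isCompact_sep_le hΦ.isClosed r).exists_mapClusterPt_of_frequently
      (eventually_mem_sep_le_of_isEquilibriumPoint_penalized hP hμ hτ hw).frequently |>.imp
        fun _ h => h.2
  have hlimit {w w'} := JointGame.mem_and_isNormalizedEquilibrium_of_mapClusterPt hΦ hP hμ
    hG.feasible_nonempty hZ hτ (w := w) (w' := w')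
  choose! w hw using hsol
  have hwτ : ∀ᶠ k in L, G.IsPenalizedSolution U₀ φ (τ k) (w (τ k)) :=
    (hτ.eventually_ge_atTop 0).mono fun k hk => hw (τ k) hk
  obtain ⟨w', hw'⟩ := hcluster _ hwτ
  refine ⟨⟨w'.1, (hlimit hwτ hw').2⟩, fun t ht => ⟨⟨w t, hw t ht⟩, fun v hv => ?_⟩,
    fun v hv => ⟨hcluster v hv, fun v' hv' => hlimit hv hv'⟩⟩
  exact ⟨⟨hv.1.1, (hμ.penalized hP ht).le_of_isEquilibriumPoint hv⟩, hv.1.2⟩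

theorem theorem4p1 {l m : ℕ} {n : Fin l → ℕ} (G : JointGame l m n)
    (hA1 : G.BasicAssumptions)
    (μ : Profile n → ℝ) (r : ℝ) (hC5 : G.Coercivity μ r)
    (U₀ : Set (Shares l m)) (hU : G.AdmissibleShares U₀)
    (hUb : Bornology.IsBounded (G.shareSet U₀))
    (φ : (Fin m → ℝ) → ℝ) (hφ : IsPenaltyKernel φ)
    (τ : ℕ → ℝ) (hτpos : ∀ k, 0 < τ k) (hτmono : Monotone τ)
    (hτ : Filter.Tendsto τ Filter.atTop Filter.atTop) :
    (∃ x, G.IsNormalizedEquilibrium x) ∧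
    (∀ t : ℝ, 0 < t →
      (∃ w, G.IsPenalizedSolution U₀ φ t w) ∧
      ∀ w, G.IsPenalizedSolution U₀ φ t w → w ∈ G.levelSet μ r ×ˢ G.shareSet U₀) ∧
    (∀ w : ℕ → Profile n × Shares l m, (∀ k, G.IsPenalizedSolution U₀ φ (τ k) (w k)) →
      (∃ w', MapClusterPt w' Filter.atTop w) ∧
      ∀ w', MapClusterPt w' Filter.atTop w →
        w' ∈ (G.levelSet μ r ∩ G.feasible) ×ˢ G.shareSet U₀ ∧
        G.IsNormalizedEquilibrium w'.1) :=
  have hgen := theorem4p1_general G hA1 μ r hC5 U₀ hU hUb φ hφ.convex hφ.isotone hφ.nonneg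
    hφ.eq_zero_iff Filter.atTop τ hτ
  ⟨hgen.1, fun t ht => hgen.2.1 t ht.le, fun w hw => hgen.2.2 w (.of_forall hw)⟩
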